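/- A \emph{graded manifold} $\mathcal M=(M,\mathcal O_M)$ is a topological space $M$ with a sheaf $\mathcal O_M$ of $\mathbb Z$-graded real algebras that is locally isomorphic, as a sheaf of $\mathbb Z$-graded algebras, to the sheaf associated with $C^\infty(U)\otimes S(W^*)$, where $U\subseteq\mathbb R^n$ is open, $W$ is a finite-dimensional graded real vector space and $S(W^*)$ is the graded symmetric algebra of its dual. Let $(x^i)$ be homogeneous local coordinates, of degrees $|x^i|$ (the coordinates on $U$ have degree $0$). Differential forms on $\mathcal M$ are functions on $T[1]\mathcal M$, the graded manifold obtained by adding to local coordinates $x^i$ new coordinates $dx^i$ of degree $|x^i|+1$ (total degree); $d=\sum_i dx^i\frac{\partial}{\partial x^i}$ is the de Rham differential. The form degree counts the $dx^i$, a $p$-form is a form that is homogeneous of form degree $p$, and the degree of a form is its total degree minus its form degree. For a vector field $X=\sum_i X^i\frac{\partial}{\partial x^i}$ of degree $l$ (so $X^i$ has degree $|x^i|+l$), the contraction $\iota_X$ is the graded derivation of degree $l-1$ of the algebra of forms that vanishes on functions and satisfies $\iota_X dx^i=X^i$. The graded Euler vector field is $E=\sum_i|x^i|x^i\frac{\partial}{\partial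 x^i}$. A \emph{graded symplectic form of degree $k$} is a two-form $\omega$ that is homogeneous of degree $k$, closed ($d\omega=0$), and non-degenerate: $X\mapsto\iota_X\omega$ is an isomorphism from the sheaf of vector fields to the sheaf of one-forms shifted by $k$ (vector fields of degree $l$ correspond to one-forms of degree $l+k$). \textbf{Lemma.} Let $\omega$ be a graded symplectic form of degree $k\neq 0$ on a graded manifold $\mathcal M$. Then $\omega$ is exact, i.e. $\omega=d\alpha$ for a global one-form $\alpha$ on $\mathcal M$. Explicitly, $\iota_E\omega$ is a global one-form on $\mathcal M$ and $$\omega=\frac{d(\iota_E\omega)}{k}.$$ -/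

import Mathlib

open TopologicalSpace Topology

universe u v

noncomputable section

namespace GradedGeometry

/-! ## The graded symmetric algebra -/

/-- The relations `x i * x j = (-1) ^ (|x i| |x j|) x j * x i` between generators. -/
inductive GSymRel {J : Type} (deg : J → ℤ) : FreeAlgebra ℝ J → FreeAlgebra ℝ J → Prop
  | comm (i j : J) : GSymRel deg (FreeAlgebra.ι ℝ i * FreeAlgebra.ι ℝ j)
      ((-1 : ℝ) ^ (deg i * deg j) • (FreeAlgebra.ι ℝ j * FreeAlgebra.ι ℝ i))

/-- The graded symmetric algebra `S(W^*)`, where `W^*` is the real graded vector space with a basis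
of homogeneous elements `x j` of degree `deg j`, `j : J`: the quotient of the tensor algebra (the free
algebra on the `x j`) by the graded commutativity relations. -/
def GSym {J : Type} (deg : J → ℤ) : Type := RingQuot (GSymRel deg)

instance {J : Type} (deg : J → ℤ) : Ring (GSym deg) := inferInstanceAs (Ring (RingQuot _))

instance {J : Type} (deg : J → ℤ) : Algebra ℝ (GSym deg) :=
  inferInstanceAs (Algebra ℝ (RingQuot _))

namespace GSym

variable {J K : Type} {deg : J → ℤ} {deg' : K → ℤ}

/-- The quotient map. -/
def mk (deg : J → ℤ) : FreeAlgebra ℝ J →ₐ[ℝ] GSym deg := RingQuot.mkAlgHom ℝ (GSymRel deg)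

/-- The generator `x j`. -/
def gen (deg : J → ℤ) (j : J) : GSym deg := mk deg (FreeAlgebra.ι ℝ j)

/-- The universal property: graded commuting elements `b j` of an algebra define a morphism. -/
def lift {B : Type} [Ring B] [Algebra ℝ B] (b : J → B)
    (hb : ∀ i j, b i * b j = (-1 : ℝ) ^ (deg i * deg j) • (b j * b i)) : GSym deg →ₐ[ℝ] B :=
  RingQuot.liftAlgHom ℝ ⟨FreeAlgebra.lift ℝ b, by
    rintro _ _ ⟨i, j⟩
    simpa using hb i j⟩

theorem lift_gen {B : Type} [Ring B] [Algebra ℝ B] (b : J → B)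
    (hb : ∀ i j, b i * b j = (-1 : ℝ) ^ (deg i * deg j) • (b j * b i)) (j : J) :
    lift b hb (gen deg j) = b j := by
  change RingQuot.liftAlgHom ℝ _ (RingQuot.mkAlgHom ℝ _ _) = _
  rw [RingQuot.liftAlgHom_mkAlgHom_apply]
  simp

/-- For a weight `w` of the generators, the span of the monomials of total weight `m`. For `w = deg`
this is the component of degree `m` of the graded symmetric algebra. -/
def homog (deg : J → ℤ) (w : J → ℤ) (m : ℤ) : Submodule ℝ (GSym deg) :=
  Submodule.span ℝ {a | ∃ l : List J, (l.map w).sum = m ∧ a = (l.map (gen deg)).prod}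

theorem gen_mem_homog (w : J → ℤ) (j : J) : gen deg j ∈ homog deg w (w j) :=
  Submodule.subset_span ⟨[j], by simp, by simp⟩

theorem gen_mul_gen (i j : J) :
    gen deg i * gen deg j = (-1 : ℝ) ^ (deg i * deg j) • (gen deg j * gen deg i) := by
  have h : mk deg _ = mk deg _ := RingQuot.mkAlgHom_rel ℝ (GSymRel.comm (deg := deg) i j)
  rw [map_mul, map_smul, map_mul] at h
  exact h

theorem gen_mul_homog (i : J) {m : ℤ} {a : GSym deg} (ha : a ∈ homog deg deg m) :
    gen deg i * a = (-1 : ℝ) ^ (deg i * m) • (a * gen deg i) := by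
  induction ha using Submodule.span_induction with
  | mem a h =>
    obtain ⟨l, rfl, rfl⟩ := h
    induction l with
    | nil => simp
    | cons j l ih =>
      simp only [List.map_cons, List.prod_cons, List.sum_cons]
      rw [← mul_assoc, gen_mul_gen, smul_mul_assoc, mul_assoc, ih, mul_smul_comm, smul_smul,
        mul_add, zpow_add₀ (by norm_num), mul_assoc]
  | zero => simp
  | add a b _ _ ha hb => rw [mul_add, ha, hb, add_mul, smul_add]
  | smul r a _ ha => rw [mul_smul_comm, ha, smul_mul_assoc, smul_comm]

/-- The algebra morphism that renames the generators along a map preserving the degrees. -/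
def rename (e : J → K) (he : ∀ j, deg' (e j) = deg j) : GSym deg →ₐ[ℝ] GSym deg' :=
  lift (fun j => gen deg' (e j)) fun i j => by rw [gen_mul_gen, he, he]

theorem rename_gen (e : J → K) (he : ∀ j, deg' (e j) = deg j) (j : J) :
    rename e he (gen deg j) = gen deg' (e j) :=
  lift_gen _ _ j

theorem rename_mem_homog (e : J → K) (he : ∀ j, deg' (e j) = deg j) {m : ℤ} {a : GSym deg}
    (ha : a ∈ homog deg deg m) : rename e he a ∈ homog deg' deg' m := by
  induction ha using Submodule.span_induction with
  | mem a h =>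
    obtain ⟨l, rfl, rfl⟩ := h
    refine Submodule.subset_span ⟨l.map e, ?_, ?_⟩
    · rw [List.map_map]
      exact congrArg List.sum (List.map_congr_left fun j _ => he j)
    · rw [map_list_prod, List.map_map, List.map_map]
      exact congrArg List.prod (List.map_congr_left fun j _ => rename_gen e he j)
  | zero => simp
  | add a b _ _ ha hb => rw [map_add]; exact add_mem ha hb
  | smul r a _ ha => rw [map_smul]; exact Submodule.smul_mem _ _ ha

section

variable (e : ℤ) (v : J → GSym deg) (hv : ∀ j, v j ∈ homog deg deg (deg j + e))

/-- Auxiliary to `superDer`: a graded derivation `D` of degree `e`, packaged as the algebra morphism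
`a ↦ [[(-1) ^ (e |a|) a, D a], [0, a]]`. -/
def superDerAux : GSym deg →ₐ[ℝ] Matrix (Fin 2) (Fin 2) (GSym deg) :=
  lift (fun j => !![(-1 : ℝ) ^ (e * deg j) • gen deg j, v j; 0, gen deg j]) fun i j => by
    have key : ∀ i j : J, ((-1 : ℝ) ^ (e * deg i) • gen deg i) * v j =
        (-1 : ℝ) ^ (deg i * deg j) • (v j * gen deg i) := by
      intro i j
      rw [smul_mul_assoc, gen_mul_homog i (hv j), smul_smul, mul_add, zpow_add₀ (by norm_num),
        mul_comm (deg i) e, mul_left_comm, ← mul_zpow]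
      simp
    have sq : (-1 : ℝ) ^ (deg i * deg j) * (-1 : ℝ) ^ (deg i * deg j) = 1 := by
      rw [← mul_zpow]; simp
    ext a b
    fin_cases a <;> fin_cases b
    · simp only [Matrix.mul_apply, Fin.sum_univ_two, Matrix.smul_apply]
      simp [gen_mul_gen i j, smul_smul]
      congr 1
      ring
    · simp only [Matrix.mul_apply, Fin.sum_univ_two, Matrix.smul_apply]
      simp only [Matrix.of_apply, Matrix.cons_val', Matrix.cons_val_zero, Matrix.cons_val_one,
        Fin.zero_eta, Fin.mk_one, Matrix.cons_val_fin_one]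
      rw [key, key, mul_comm (deg j), smul_add, smul_smul, sq, one_smul, add_comm]
    · simp [Matrix.mul_apply, Fin.sum_univ_two]
    · simp [Matrix.mul_apply, Fin.sum_univ_two, gen_mul_gen i j]

/-- The graded derivation `D` of degree `e` of the graded symmetric algebra with `D (x j) = v j`,
where `v j` is homogeneous of degree `|x j| + e`; see `superDer_gen` and `superDer_mul`. -/
def superDer : GSym deg →ₗ[ℝ] GSym deg where
  toFun a := superDerAux e v hv a 0 1
  map_add' a b := by simp
  map_smul' r a := by simp

theorem superDerAux_gen (j : J) : superDerAux e v hv (gen deg j) =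
    !![(-1 : ℝ) ^ (e * deg j) • gen deg j, v j; 0, gen deg j] :=
  lift_gen _ _ j

theorem superDer_gen (j : J) : superDer e v hv (gen deg j) = v j := by
  change superDerAux e v hv (gen deg j) 0 1 = v j
  rw [superDerAux_gen]; rfl

theorem superDerAux_homog {m : ℤ} {a : GSym deg} (ha : a ∈ homog deg deg m) :
    superDerAux e v hv a 0 0 = (-1 : ℝ) ^ (e * m) • a ∧ superDerAux e v hv a 1 0 = 0 := by
  induction ha using Submodule.span_induction with
  | mem a h =>
    obtain ⟨l, rfl, rfl⟩ := h
    induction l with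
    | nil => simp
    | cons j l ih =>
      simp only [List.map_cons, List.prod_cons, map_mul, Matrix.mul_apply, Fin.sum_univ_two,
        List.sum_cons, superDerAux_gen, ih.1, ih.2]
      simp [mul_add, zpow_add₀, smul_smul, mul_comm]
  | zero => simp
  | add a b _ _ ha hb => simp [ha, hb]
  | smul r a _ ha => rw [map_smul, Matrix.smul_apply, Matrix.smul_apply, ha.1, ha.2, smul_comm, smul_zero]; exact ⟨rfl, rfl⟩

theorem superDerAux_one_one (a : GSym deg) : superDerAux e v hv a 1 1 = a := by
  obtain ⟨a, rfl⟩ : ∃ b, mk deg b = a := RingQuot.mkAlgHom_surjective ℝ (GSymRel deg) a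
  suffices h : superDerAux e v hv (mk deg a) 1 0 = 0 ∧
      superDerAux e v hv (mk deg a) 1 1 = mk deg a from h.2
  induction a using FreeAlgebra.induction with
  | grade0 r =>
    rw [AlgHom.commutes, AlgHom.commutes]
    exact ⟨Matrix.algebraMap_matrix_apply.trans (if_neg (by decide)),
      Matrix.algebraMap_matrix_apply.trans (if_pos rfl)⟩
  | grade1 j =>
    change superDerAux e v hv (gen deg j) 1 0 = 0 ∧ superDerAux e v hv (gen deg j) 1 1 = gen deg j
    simp [superDerAux_gen]
  | add a b ha hb => simp [ha, hb]
  | mul a b ha hb => simp [Matrix.mul_apply, Fin.sum_univ_two, ha, hb]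

/-- The graded Leibniz rule. -/
theorem superDer_mul {m : ℤ} {a : GSym deg} (ha : a ∈ homog deg deg m) (b : GSym deg) :
    superDer e v hv (a * b) =
      superDer e v hv a * b + (-1 : ℝ) ^ (e * m) • (a * superDer e v hv b) := by
  change superDerAux e v hv (a * b) 0 1 =
    superDerAux e v hv a 0 1 * b + (-1 : ℝ) ^ (e * m) • (a * superDerAux e v hv b 0 1)
  rw [map_mul, Matrix.mul_apply, Fin.sum_univ_two, (superDerAux_homog e v hv ha).1,
    superDerAux_one_one e v hv b, smul_mul_assoc, add_comm]

end

end GSym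

/-! ## Graded manifolds -/

/-- A topological space with a sheaf of `ℤ`-graded real algebras. Limits of graded algebras are formed
degree by degree, so the sheaf axiom is imposed on each homogeneous component. -/
structure GradedRingedSpace (M : Type u) [TopologicalSpace M] where
  /-- The algebra of functions on an open set. -/
  O : Opens M → Type v
  [ring : ∀ V, Ring (O V)]
  [algebra : ∀ V, Algebra ℝ (O V)]
  /-- The functions of a given degree. -/
  gr : ∀ V, ℤ → Submodule ℝ (O V)
  [graded : ∀ V, GradedAlgebra (gr V)]
  /-- Restriction of functions. -/
  res : ∀ {V W : Opens M}, W ≤ V → O V →ₐ[ℝ] O W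
  res_mem : ∀ {V W : Opens M} (h : W ≤ V) (m : ℤ) (f : O V), f ∈ gr V m → res h f ∈ gr W m
  res_self : ∀ {V : Opens M} (f : O V), res le_rfl f = f
  res_res : ∀ {V W Z : Opens M} (h : W ≤ V) (h' : Z ≤ W) (f : O V),
    res h' (res h f) = res (h'.trans h) f
  glue : ∀ (m : ℤ) (I : Type u) (V : I → Opens M) (f : ∀ i, O (V i)), (∀ i, f i ∈ gr (V i) m) →
    (∀ i j, res (inf_le_left : V i ⊓ V j ≤ V i) (f i) =
      res (inf_le_right : V i ⊓ V j ≤ V j) (f j)) →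
    ∃! g : O (iSup V), g ∈ gr (iSup V) m ∧ ∀ i, res (le_iSup V i) g = f i

attribute [instance] GradedRingedSpace.ring GradedRingedSpace.algebra GradedRingedSpace.graded

section Local

variable {M : Type u} [TopologicalSpace M] {n : ℕ}
  (φ : OpenPartialHomeomorph M (EuclideanSpace ℝ (Fin n)))
  {A : Type} [AddCommGroup A] [Module ℝ A] {V : Opens M}

/-- For a coordinate system `φ` defined on `V`: `s` is a section over `V` of the sheaf associated with
the presheaf `V ↦ C^∞(φ(V)) ⊗ A`. That is, locally `s` is a finite sum of smooth functions of the
coordinates times constant elements of the vector space `A`. -/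
def IsSmoothSection (s : V → A) : Prop :=
  ∀ x : V, ∃ N ∈ 𝓝 (φ x), ∃ (q : ℕ) (f : Fin q → EuclideanSpace ℝ (Fin n) → ℝ) (a : Fin q → A),
    (∀ i, ContDiffOn ℝ ((⊤ : ℕ∞) : WithTop ℕ∞) (f i) N) ∧ ∀ y : V, φ y ∈ N → s y = ∑ i, f i (φ y) • a i

open Classical in
/-- `s` as a function of the coordinates, extended by zero outside of `φ(V)`. -/
def inCoordinates (s : V → A) (q : EuclideanSpace ℝ (Fin n)) : A :=
  if h : q ∈ φ.target ∧ φ.symm q ∈ V then s ⟨φ.symm q, h.2⟩ else 0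

/-- The partial derivative of `s` with respect to the `i`-th coordinate of `φ`, computed component by
component in a basis of `A`. For a smooth section the sum has finite support, and if locally
`s = ∑ f j • a j`, then the partial derivative is `∑ (∂ f j / ∂ x i) • a j`, in every basis. -/
def partialDeriv (i : Fin n) (s : V → A) (x : V) : A :=
  ∑ᶠ b, lineDeriv ℝ (fun q => (Module.Basis.ofVectorSpace ℝ A).repr (inCoordinates φ s q) b) (φ x)
    (EuclideanSpace.single i 1) • Module.Basis.ofVectorSpace ℝ A b

end Local

variable {M : Type u} [TopologicalSpace M]

/-- A chart of a graded ringed space: an isomorphism of its restriction to the open set `φ.source` with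
the local model `(φ.target, C^∞ ⊗ S(W^*))`, where `W^*` is a finite dimensional graded vector space
with homogeneous basis `x 1, …, x r` of degrees `deg`. The isomorphism consists of the homeomorphism
`φ` and of isomorphisms `val` between graded algebras of sections, compatible with restrictions. -/
structure Chart (X : GradedRingedSpace.{u, v} M) where
  /-- The number of coordinates on the base. -/
  n : ℕ
  /-- The number of further coordinates. -/
  r : ℕ
  /-- The degrees of the further coordinates. -/
  deg : Fin r → ℤ
  /-- The coordinate system on the base. -/
  φ : OpenPartialHomeomorph M (EuclideanSpace ℝ (Fin n))
  /-- The expression of a function in the local model. -/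
  val : ∀ V : Opens M, (V : Set M) ⊆ φ.source → X.O V →ₐ[ℝ] (V → GSym deg)
  val_injective : ∀ (V : Opens M) (hV : (V : Set M) ⊆ φ.source), Function.Injective (val V hV)
  val_range : ∀ (V : Opens M) (hV : (V : Set M) ⊆ φ.source) (m : ℤ) (s : V → GSym deg), (∃ f ∈ X.gr V m, val V hV f = s) ↔
    IsSmoothSection φ s ∧ ∀ y, s y ∈ GSym.homog deg deg m
  val_res : ∀ (V W : Opens M) (hV : (V : Set M) ⊆ φ.source) (h : W ≤ V) (f : X.O V) (y : W),
    val W (fun _ hz => hV (h hz)) (X.res h f) y = val V hV f ⟨y, h y.2⟩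

/-- A graded manifold: a topological space with a sheaf of `ℤ`-graded algebras that is locally
isomorphic to `(U, C^∞(U) ⊗ S(W^*))`. -/
structure GradedManifold (M : Type u) [TopologicalSpace M] extends
    GradedRingedSpace.{u, v} M where
  exists_chart : ∀ x : M, ∃ c : Chart toGradedRingedSpace, x ∈ c.φ.source

/-! ## Differential forms, vector fields and contraction in a chart -/

namespace Chart

variable {X : GradedRingedSpace.{u, v} M} (c : Chart X)

/-- The domain of a chart. -/
def source : Opens M := ⟨c.φ.source, c.φ.open_source⟩

/-- The degrees of all the coordinates, those on the base (which have degree `0`) and the others. -/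
def coordDeg : Fin c.n ⊕ Fin c.r → ℤ := Sum.elim (fun _ => 0) c.deg

/-- The coordinate functions on an open subset of the domain of the chart. -/
def coord (V : Opens M) : Fin c.n ⊕ Fin c.r → V → GSym c.deg :=
  Sum.elim (fun i y => (c.φ y i) • 1) (fun j _ => GSym.gen c.deg j)

/-- The corresponding chart of `T[1]M` has the same base coordinates, and as further coordinates those
of `M` together with one new coordinate `dx i` of degree `|x i| + 1` for each coordinate `x i` of `M`.
This is the (total) degree of these further coordinates. -/
def totalDeg : Fin c.r ⊕ (Fin c.n ⊕ Fin c.r) → ℤ := Sum.elim c.deg (fun i => c.coordDeg i + 1)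

/-- The form degree counts the `dx i`. -/
def formDeg : Fin c.r ⊕ (Fin c.n ⊕ Fin c.r) → ℤ := Sum.elim (fun _ => 0) (fun _ => 1)

/-- The degree of a form is the difference between the total degree and the form degree. -/
def degree (j : Fin c.r ⊕ (Fin c.n ⊕ Fin c.r)) : ℤ := c.totalDeg j - c.formDeg j

/-- The fibre `S(W^* ⊕ (ℝ^n ⊕ W)^*[-1])` of the functions on the chart of `T[1]M`. A differential form
over `V` is, in the chart, a function `V → c.Fibre` that is an `IsSmoothSection`. -/
abbrev Fibre : Type := GSym c.totalDeg

/-- The new coordinate `dx i`. -/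
def dx (i : Fin c.n ⊕ Fin c.r) : c.Fibre := GSym.gen c.totalDeg (Sum.inr i)

/-- Functions on `M` are functions on `T[1]M`. -/
def incl : GSym c.deg →ₐ[ℝ] c.Fibre := GSym.rename Sum.inl fun _ => rfl

/-- The derivation of degree `1` with `x j ↦ dx j` and `dx i ↦ 0`, for the coordinates `x j` that are
not on the base. -/
def dFibre : c.Fibre →ₗ[ℝ] c.Fibre :=
  GSym.superDer 1 (Sum.elim (fun j => c.dx (Sum.inr j)) (fun _ => 0)) (by
    rintro (j | i)
    · have h : c.totalDeg (Sum.inl j) + 1 = c.totalDeg (Sum.inr (Sum.inr j)) := by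
        simp only [totalDeg, coordDeg, Sum.elim_inl, Sum.elim_inr]
      rw [h]
      exact GSym.gen_mem_homog c.totalDeg (Sum.inr (Sum.inr j))
    · exact Submodule.zero_mem _)

/-- The de Rham differential, that is, the vector field `∑ dx i ∂/∂x i` on the chart of `T[1]M`. -/
def d {V : Opens M} (s : V → c.Fibre) (y : V) : c.Fibre :=
  (∑ i : Fin c.n, c.dx (Sum.inl i) * partialDeriv c.φ i s y) + c.dFibre (s y)

/-- A vector field `∑ X^i ∂/∂x i` of degree `l` over `V`: the coefficient `X^i` is a function of degree
`|x i| + l`. -/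
structure VectorField (V : Opens M) (l : ℤ) where
  /-- The coefficients. -/
  coeff : Fin c.n ⊕ Fin c.r → V → GSym c.deg
  smooth : ∀ i, IsSmoothSection c.φ (coeff i)
  homog : ∀ i y, coeff i y ∈ GSym.homog c.deg c.deg (c.coordDeg i + l)

variable {c}

/-- The contraction with a vector field `X` of degree `l`: the derivation of degree `l - 1` that vanishes
on functions and maps `dx i` to `X^i`. -/
def contract {V : Opens M} {l : ℤ} (Y : c.VectorField V l) (s : V → c.Fibre) (y : V) : c.Fibre :=
  GSym.superDer (l - 1) (Sum.elim (fun _ => 0) (fun i => c.incl (Y.coeff i y))) (by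
    rintro (j | i)
    · exact Submodule.zero_mem _
    · have h : c.totalDeg (Sum.inr i) + (l - 1) = c.coordDeg i + l := by
        simp only [totalDeg, Sum.elim_inr]; ring
      rw [h]
      exact GSym.rename_mem_homog _ _ (Y.homog i y)) (s y)

variable (c)

/-- The graded Euler vector field `E = ∑ |x i| x i ∂/∂x i`. -/
def euler (V : Opens M) : c.VectorField V 0 where
  coeff i y := (c.coordDeg i : ℝ) • c.coord V i y
  smooth i x := by
    refine ⟨Set.univ, Filter.univ_mem, 1, fun _ _ => 1, fun _ => (c.coordDeg i : ℝ) • c.coord V i x,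
      fun _ => contDiffOn_const, fun y _ => ?_⟩
    rcases i with i | j <;> simp [coordDeg, coord]
  homog i y := by
    rcases i with i | j
    · simp [coordDeg]
    · simpa [coordDeg, coord] using
        Submodule.smul_mem _ _ (GSym.gen_mem_homog (deg := c.deg) c.deg j)

/-- A function on an open subset `V` of `M`, expressed in the part of the chart that lies over `V`, and
seen as a form. -/
def expr (V : Opens M) (f : X.O V) (y : ↥(V ⊓ c.source)) : c.Fibre :=
  c.incl (c.val (V ⊓ c.source) inf_le_right (X.res inf_le_left f) y)

end Chart

/-! ## Global differential forms and graded symplectic forms -/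

namespace GradedManifold

variable (X : GradedManifold.{u, v} M)

/-- Families of expressions, one in each chart of `T[1]M`. -/
abbrev LocalForms : Type (max u v) :=
  ∀ c : Chart X.toGradedRingedSpace, c.source → c.Fibre

variable {X}

/-- `ω` is a (global) differential form of form degree `p`. The transition maps of `T[1]M` map a
function `f` of `M` to `f` and `dg` to `dg`, hence the expressions in the charts fit together to a
function of `T[1]M` that is homogeneous of degree `p` in the `dx i` if and only if near each point, in
all the charts simultaneously, they express one finite sum `∑ f_a dg_{a,1} ⋯ dg_{a,p}`. -/
def IsForm (p : ℕ) (ω : X.LocalForms) : Prop :=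
  ∀ x : M, ∃ V : Opens M, x ∈ V ∧ ∃ (q : ℕ) (f : Fin q → X.O V) (g : Fin q → Fin p → X.O V),
    ∀ (c : Chart X.toGradedRingedSpace) (y : ↥(V ⊓ c.source)), ω c ⟨y, y.2.2⟩ =
      ∑ a, c.expr V (f a) y * (List.ofFn fun i => c.d (c.expr V (g a i)) y).prod

/-- `ω` is homogeneous of degree `k` (not counting the form degree). -/
def IsHomogeneous (k : ℤ) (ω : X.LocalForms) : Prop :=
  ∀ c y, ω c y ∈ GSym.homog c.totalDeg c.degree k

/-- The de Rham differential. -/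
def d (ω : X.LocalForms) : X.LocalForms := fun c => c.d (ω c)

/-- The contraction with the graded Euler vector field. -/
def contractEuler (ω : X.LocalForms) : X.LocalForms := fun c =>
  Chart.contract (c.euler c.source) (ω c)

/-- `ω` is non-degenerate as a two-form of degree `k`: the morphism `Y ↦ ι_Y ω` from vector fields to
one-forms shifted by `k` is an isomorphism of sheaves. In a chart, over each open set, every one-form of
degree `l + k` is the contraction with a unique vector field of degree `l`. -/
def IsNondegenerate (k : ℤ) (ω : X.LocalForms) : Prop :=
  ∀ (c : Chart X.toGradedRingedSpace) (V : Opens M) (hV : V ≤ c.source) (l : ℤ) (η : V → c.Fibre),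
    IsSmoothSection c.φ η → (∀ y, η y ∈ GSym.homog c.totalDeg c.formDeg 1) →
    (∀ y, η y ∈ GSym.homog c.totalDeg c.degree (l + k)) →
    ∃! Y : c.VectorField V l, Chart.contract Y (fun y => ω c ⟨y, hV y.2⟩) = η

/-- `ω` is a graded symplectic form of degree `k`. -/
structure IsGradedSymplectic (k : ℤ) (ω : X.LocalForms) : Prop where
  isForm : IsForm 2 ω
  homogeneous : IsHomogeneous k ω
  closed : d ω = 0
  nondegenerate : IsNondegenerate k ω

/-- The two-form `ω` is exact: it is the differential of a one-form. -/
def IsExact (ω : X.LocalForms) : Prop := ∃ α : X.LocalForms, IsForm 1 α ∧ d α = ω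

end GradedManifold

end GradedGeometry

end

/-!
The theorem is Cartan's formula for the Euler vector field `E`. The operator `L = ι_E d + d ι_E` is a
derivation of degree `0` that multiplies each of the coordinates `x i` and `dx i` by `|x i|`, hence
multiplies a form of degree `k` by `k` (`Chart.eulerContraction_d_add`). For closed `ω` this reads
`d (ι_E ω) = k ω` (`GradedManifold.d_contractEuler`), and one divides by `k ≠ 0`.

In a chart the components of `E` along the base coordinates vanish, as these have degree `0`. So `ι_E`
is one and the same linear map of the fibre at all points (`Chart.eulerContraction`), and it commutes
with the partial derivatives along the base. The part `∑ dx i ∂/∂x i` of `d` that belongs to the base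
therefore anticommutes with `ι_E`, and the formula reduces to an algebraic one for two derivations of
a graded symmetric algebra (`GSym.superDer_anticommutator`).
The de Rham differential is defined by partial derivatives in a basis, which are meaningful on smooth
sections only; the expressions of a two-form are smooth because they are sums of products of functions
and their differentials (`GradedManifold.IsForm.isSmoothSection`).

That `ι_E ω` is a global one-form (`GradedManifold.IsForm.contractEuler`) holds because `E` does not
depend on the chart: it multiplies a function of degree `m` by `m`. Locally `ω` is a sum of terms
`f dg dh`, and after a decomposition of `f`, `g` and `h` into homogeneous components, `ι_E (f dg dh)` is
a combination of `f g dh` and `f h dg`, with coefficients that depend only on the degrees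
(`Chart.eulerContraction_expr_mul_d_mul_d`).
-/

namespace GradedGeometry

/-! ### Graded symmetric algebras and their derivations -/

namespace GSym

variable {J K : Type} {deg : J → ℤ} {deg' : K → ℤ}

theorem one_mem_homog (w : J → ℤ) : (1 : GSym deg) ∈ homog deg w 0 :=
  Submodule.subset_span ⟨[], by simp, by simp⟩

theorem mul_mem_homog {w : J → ℤ} {m n : ℤ} {a b : GSym deg} (ha : a ∈ homog deg w m)
    (hb : b ∈ homog deg w n) : a * b ∈ homog deg w (m + n) := by
  have h := Submodule.mul_mem_mul ha hb
  rw [homog, homog, Submodule.span_mul_span] at h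
  refine Submodule.span_mono ?_ h
  rintro _ ⟨_, ⟨l, rfl, rfl⟩, _, ⟨l', rfl, rfl⟩, rfl⟩
  exact ⟨l ++ l', by simp, by simp⟩

/-- Induction on a homogeneous element, by way of the monomials. -/
theorem homog_induction {w : J → ℤ} {motive : ℤ → GSym deg → Prop}
    (one : motive 0 1)
    (gen_mul : ∀ (j : J) (m : ℤ) (a : GSym deg), a ∈ homog deg w m → motive m a →
      motive (w j + m) (gen deg j * a))
    (zero : ∀ m, motive m 0)
    (add : ∀ m a b, motive m a → motive m b → motive m (a + b))
    (smul : ∀ m (r : ℝ) a, motive m a → motive m (r • a))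
    {m : ℤ} {a : GSym deg} (ha : a ∈ homog deg w m) : motive m a := by
  induction ha using Submodule.span_induction with
  | mem a h =>
    obtain ⟨l, rfl, rfl⟩ := h
    induction l with
    | nil => simpa using one
    | cons j l ih =>
      simp only [List.map_cons, List.prod_cons, List.sum_cons]
      exact gen_mul j _ _ (Submodule.subset_span ⟨l, rfl, rfl⟩) ih
  | zero => exact zero _
  | add a b _ _ ha hb => exact add _ _ _ ha hb
  | smul r a _ ha => exact smul _ r a ha

/-- Graded commutativity. -/
theorem homog_mul_homog {m n : ℤ} {a b : GSym deg} (ha : a ∈ homog deg deg m)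
    (hb : b ∈ homog deg deg n) : a * b = (-1 : ℝ) ^ (m * n) • (b * a) := by
  refine homog_induction (motive := fun m a => a * b = (-1 : ℝ) ^ (m * n) • (b * a))
    (by simp) ?_ (by simp) ?_ ?_ ha
  · intro j m a _ ih
    rw [mul_assoc, ih, mul_smul_comm, ← mul_assoc, gen_mul_homog j hb, smul_mul_assoc, smul_smul,
      add_mul, zpow_add₀ (by norm_num), mul_comm ((-1 : ℝ) ^ (m * n)), mul_assoc]
  · intro m a a' h h'
    rw [add_mul, h, h', mul_add, smul_add]
  · intro m r a h
    rw [smul_mul_assoc, h, mul_smul_comm, smul_comm]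

section

variable (e : ℤ) (v : J → GSym deg) (hv : ∀ j, v j ∈ homog deg deg (deg j + e))

theorem superDer_congr {e' : ℤ} {v' : J → GSym deg} (he : e = e') (h : v = v') :
    superDer e v hv = superDer e' v' (by subst he h; exact hv) := by
  subst he h; rfl

theorem superDer_one : superDer e v hv 1 = 0 := by
  change superDerAux e v hv 1 0 1 = 0
  rw [map_one]; rfl

/-- The value of a derivation of degree `e` on a monomial, one generator at a time. -/
theorem superDer_gen_mul (j : J) (a : GSym deg) : superDer e v hv (gen deg j * a) =
    v j * a + (-1 : ℝ) ^ (e * deg j) • (gen deg j * superDer e v hv a) := by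
  rw [superDer_mul e v hv (gen_mem_homog deg j), superDer_gen]

/-- A derivation of degree `e` raises degrees by `e`. -/
theorem superDer_mem_homog {m : ℤ} {a : GSym deg} (ha : a ∈ homog deg deg m) :
    superDer e v hv a ∈ homog deg deg (m + e) := by
  refine homog_induction (motive := fun m a => superDer e v hv a ∈ homog deg deg (m + e))
    (by simp [superDer_one]) ?_ (by simp) ?_ ?_ ha
  · intro j m a ha ih
    rw [superDer_gen_mul]
    refine add_mem ?_ (Submodule.smul_mem _ _ ?_)
    · have := mul_mem_homog (hv j) ha
      rwa [add_right_comm] at this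
    · have := mul_mem_homog (gen_mem_homog (deg := deg) deg j) ih
      rwa [← add_assoc] at this
  · intro m a b h h'
    rw [map_add]; exact add_mem h h'
  · intro m r a h
    rw [map_smul]; exact Submodule.smul_mem _ _ h

/-- A graded derivation vanishes on the subalgebra generated by generators on which it vanishes. -/
theorem superDer_rename_eq_zero (f : K → J) (hf : ∀ k, deg (f k) = deg' k)
    (h0 : ∀ k, v (f k) = 0) {m : ℤ} {a : GSym deg'} (ha : a ∈ homog deg' deg' m) :
    superDer e v hv (rename f hf a) = 0 := by
  refine homog_induction (motive := fun _ a => superDer e v hv (rename f hf a) = 0)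
    (by simp [superDer_one]) ?_ (by simp) ?_ ?_ ha
  · intro j m a ha ih
    rw [map_mul, rename_gen, superDer_gen_mul, ih, h0]
    simp
  · intro m a b h h'
    rw [map_add, map_add, h, h', add_zero]
  · intro m r a h
    rw [map_smul, map_smul, h, smul_zero]

end

/-- The anticommutator of two graded derivations of degrees `-1` and `1` is a derivation of degree `0`.
If it multiplies each generator by its weight, then it multiplies every element by its weight. -/
theorem superDer_anticommutator (v v' : J → GSym deg)
    (hv : ∀ j, v j ∈ homog deg deg (deg j + -1)) (hv' : ∀ j, v' j ∈ homog deg deg (deg j + 1))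
    (w : J → ℤ)
    (h : ∀ j, superDer (-1) v hv (v' j) + superDer 1 v' hv' (v j) = (w j : ℝ) • gen deg j)
    {m : ℤ} {a : GSym deg} (ha : a ∈ homog deg w m) :
    superDer (-1) v hv (superDer 1 v' hv' a) + superDer 1 v' hv' (superDer (-1) v hv a) =
      (m : ℝ) • a := by
  refine homog_induction (motive := fun m a =>
    superDer (-1) v hv (superDer 1 v' hv' a) + superDer 1 v' hv' (superDer (-1) v hv a) =
      (m : ℝ) • a) (by simp [superDer_one]) ?_ (by simp) ?_ ?_ ha
  · intro j m a _ ih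
    rw [superDer_gen_mul, superDer_gen_mul, map_add, map_add, map_smul, map_smul,
      superDer_gen_mul, superDer_gen_mul, superDer_mul _ v hv (hv' j), superDer_mul _ v' hv' (hv j)]
    have s1 : (-1 : ℝ) ^ (-1 * deg j) = (-1 : ℝ) ^ (deg j) := by simp [zpow_neg, ← inv_zpow]
    have s2 : (-1 : ℝ) ^ (-1 * (deg j + 1)) = -(-1 : ℝ) ^ (deg j) := by
      rw [neg_one_mul, zpow_neg, ← inv_zpow, zpow_add₀ (by norm_num)]; norm_num
    have s3 : (-1 : ℝ) ^ (1 * (deg j + -1)) = -(-1 : ℝ) ^ (deg j) := by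
      rw [one_mul, zpow_add₀ (by norm_num)]; norm_num
    have sq : (-1 : ℝ) ^ (deg j) * (-1 : ℝ) ^ (deg j) = 1 := by rw [← mul_zpow]; simp
    rw [s1, s2, s3, one_mul]
    simp only [smul_add, smul_smul, sq, one_smul, neg_smul]
    calc _ = (superDer (-1) v hv (v' j) + superDer 1 v' hv' (v j)) * a + gen deg j *
          (superDer (-1) v hv (superDer 1 v' hv' a) + superDer 1 v' hv' (superDer (-1) v hv a)) := by
          rw [add_mul, mul_add]; abel
      _ = _ := by
          rw [h, ih, smul_mul_assoc, mul_smul_comm, ← add_smul, Int.cast_add]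
  · intro m a b h h'
    simp only [map_add, smul_add, ← h, ← h']
    abel
  · intro m r a h
    rw [map_smul, map_smul, map_smul, map_smul, ← smul_add, h, smul_comm]

end GSym

/-! ### Smooth sections and their partial derivatives -/

section Local

variable {M : Type u} [TopologicalSpace M] {n : ℕ}
  {φ : OpenPartialHomeomorph M (EuclideanSpace ℝ (Fin n))}
  {A : Type} [AddCommGroup A] [Module ℝ A] {B : Type} [AddCommGroup B] [Module ℝ B] {V W : Opens M}

theorem IsSmoothSection.of_fintype {s : V → A}
    (h : ∀ x : V, ∃ N ∈ 𝓝 (φ x), ∃ (ι : Type) (_ : Fintype ι)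
      (f : ι → EuclideanSpace ℝ (Fin n) → ℝ) (a : ι → A),
      (∀ i, ContDiffOn ℝ ((⊤ : ℕ∞) : WithTop ℕ∞) (f i) N) ∧
        ∀ y : V, φ y ∈ N → s y = ∑ i, f i (φ y) • a i) :
    IsSmoothSection φ s := by
  intro x
  obtain ⟨N, hN, ι, _, f, a, hf, hs⟩ := h x
  refine ⟨N, hN, Fintype.card ι, fun i => f ((Fintype.equivFin ι).symm i),
    fun i => a ((Fintype.equivFin ι).symm i), fun i => hf _, fun y hy => ?_⟩
  rw [hs y hy]
  exact ((Fintype.equivFin ι).symm.sum_comp fun i => f i (φ y) • a i).symm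

theorem IsSmoothSection.exists_isOpen {s : V → A} (h : IsSmoothSection φ s) (x : V) :
    ∃ N, IsOpen N ∧ φ x ∈ N ∧ ∃ (q : ℕ) (f : Fin q → EuclideanSpace ℝ (Fin n) → ℝ)
      (a : Fin q → A), (∀ i, ContDiffOn ℝ ((⊤ : ℕ∞) : WithTop ℕ∞) (f i) N) ∧
        ∀ y : V, φ y ∈ N → s y = ∑ i, f i (φ y) • a i := by
  obtain ⟨N, hN, q, f, a, hf, hs⟩ := h x
  exact ⟨interior N, isOpen_interior, mem_interior_iff_mem_nhds.2 hN, q, f, a,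
    fun i => (hf i).mono interior_subset, fun y hy => hs y (interior_subset hy)⟩

theorem IsSmoothSection.const (a : A) : IsSmoothSection φ (fun _ : V => a) := fun _ =>
  ⟨Set.univ, Filter.univ_mem, 1, fun _ _ => 1, fun _ => a, fun _ => contDiffOn_const, by simp⟩

theorem IsSmoothSection.map {s : V → A} (h : IsSmoothSection φ s) (T : A →ₗ[ℝ] B) :
    IsSmoothSection φ (fun y => T (s y)) := by
  intro x
  obtain ⟨N, hN, q, f, a, hf, hs⟩ := h x
  exact ⟨N, hN, q, f, fun i => T (a i), hf, fun y hy => by simp [hs y hy]⟩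

theorem IsSmoothSection.add {s t : V → A} (hs : IsSmoothSection φ s) (ht : IsSmoothSection φ t) :
    IsSmoothSection φ (fun y => s y + t y) := by
  refine .of_fintype fun x => ?_
  obtain ⟨N, hN, q, f, a, hf, h⟩ := hs x
  obtain ⟨N', hN', q', f', a', hf', h'⟩ := ht x
  refine ⟨N ∩ N', Filter.inter_mem hN hN', Fin q ⊕ Fin q', inferInstance, Sum.elim f f',
    Sum.elim a a', ?_, fun y hy => by simp [h y hy.1, h' y hy.2]⟩
  rintro (i | i)
  · exact (hf i).mono Set.inter_subset_left
  · exact (hf' i).mono Set.inter_subset_right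

theorem IsSmoothSection.sum {ι : Type} (S : Finset ι) {s : ι → V → A}
    (hs : ∀ i, IsSmoothSection φ (s i)) : IsSmoothSection φ (fun y => ∑ i ∈ S, s i y) := by
  classical
  induction S using Finset.induction_on with
  | empty => simpa using IsSmoothSection.const (φ := φ) (V := V) (0 : A)
  | insert i S hi ih => simpa [Finset.sum_insert hi] using (hs i).add ih

theorem IsSmoothSection.mul {A : Type} [Ring A] [Algebra ℝ A] {s t : V → A}
    (hs : IsSmoothSection φ s) (ht : IsSmoothSection φ t) :
    IsSmoothSection φ (fun y => s y * t y) := by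
  refine .of_fintype fun x => ?_
  obtain ⟨N, hN, q, f, a, hf, h⟩ := hs x
  obtain ⟨N', hN', q', f', a', hf', h'⟩ := ht x
  refine ⟨N ∩ N', Filter.inter_mem hN hN', Fin q × Fin q', inferInstance,
    fun i z => f i.1 z * f' i.2 z, fun i => a i.1 * a' i.2, fun i => ?_, fun y hy => ?_⟩
  · exact ((hf i.1).mono Set.inter_subset_left).mul ((hf' i.2).mono Set.inter_subset_right)
  · rw [h y hy.1, h' y hy.2, Finset.sum_mul_sum, Fintype.sum_prod_type]
    simp [smul_smul, mul_comm (f' _ _)]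

theorem nhds_inter_preimage_symm (hV : (V : Set M) ⊆ φ.source) (x : V) :
    {q | q ∈ φ.target ∧ φ.symm q ∈ V} ∈ 𝓝 (φ x) := by
  have hx := hV x.2
  refine Filter.inter_mem (φ.open_target.mem_nhds (φ.map_source hx)) ?_
  have := φ.symm.continuousAt (x := φ x) (φ.map_source hx)
  refine this.preimage_mem_nhds (V.2.mem_nhds ?_)
  rw [φ.left_inv hx]; exact x.2

/-- Smoothness is a local property. -/
theorem IsSmoothSection.of_local (hW : (W : Set M) ⊆ φ.source) {s : W → A}
    (h : ∀ x : W, ∃ (V : Opens M) (hV : V ≤ W), x.1 ∈ V ∧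
      IsSmoothSection φ (fun y : V => s ⟨y, hV y.2⟩)) : IsSmoothSection φ s := by
  intro x
  obtain ⟨V, hV, hx, hs⟩ := h x
  obtain ⟨N, hN, q, f, a, hf, h⟩ := hs ⟨x, hx⟩
  have hVs : (V : Set M) ⊆ φ.source := fun z hz => hW (hV hz)
  refine ⟨N ∩ _, Filter.inter_mem hN (nhds_inter_preimage_symm hVs ⟨x, hx⟩), q, f, a,
    fun i => (hf i).mono Set.inter_subset_left, fun y hy => ?_⟩
  have hy' := hy.2.2
  rw [φ.left_inv (hW y.2)] at hy'
  exact h ⟨y, hy'⟩ hy.1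

/-- The partial derivative of a finite sum of functions of the coordinates times constants is computed
term by term, whatever the constants are. -/
theorem partialDeriv_eq_sum (hV : (V : Set M) ⊆ φ.source) {s : V → A} {x : V}
    {N : Set (EuclideanSpace ℝ (Fin n))} (hN : N ∈ 𝓝 (φ x)) {ι : Type} [Fintype ι]
    {f : ι → EuclideanSpace ℝ (Fin n) → ℝ} {a : ι → A}
    (hf : ∀ j, DifferentiableAt ℝ (f j) (φ x))
    (hs : ∀ y : V, φ y ∈ N → s y = ∑ j, f j (φ y) • a j) (i : Fin n) :
    partialDeriv φ i s x =
      ∑ j, fderiv ℝ (f j) (φ x) (EuclideanSpace.single i 1) • a j := by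
  set e : EuclideanSpace ℝ (Fin n) := EuclideanSpace.single i 1
  have heq : inCoordinates φ s =ᶠ[𝓝 (φ x)] fun q => ∑ j, f j q • a j := by
    filter_upwards [nhds_inter_preimage_symm hV x, hN] with q hq hqN
    have hr := φ.right_inv hq.1
    rw [inCoordinates, dif_pos hq, hs ⟨_, hq.2⟩ (by rwa [hr]), hr]
  set β := Module.Basis.ofVectorSpace ℝ A
  have hb : ∀ b, lineDeriv ℝ (fun q => β.repr (inCoordinates φ s q) b) (φ x) e =
      β.repr (∑ j, fderiv ℝ (f j) (φ x) e • a j) b := by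
    intro b
    have h1 : (fun q => β.repr (inCoordinates φ s q) b) =ᶠ[𝓝 (φ x)]
        fun q => ∑ j, f j q * β.repr (a j) b := by
      filter_upwards [heq] with q hq
      simp [hq, Finsupp.finsetSum_apply]
    have h2 : HasFDerivAt (fun q => ∑ j, f j q * β.repr (a j) b)
        (∑ j, β.repr (a j) b • fderiv ℝ (f j) (φ x)) (φ x) :=
      HasFDerivAt.fun_sum fun j _ => (hf j).hasFDerivAt.mul_const _
    rw [h1.lineDeriv_eq, h2.differentiableAt.lineDeriv_eq_fderiv, h2.fderiv]
    simp [Finsupp.finsetSum_apply, mul_comm]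
  rw [partialDeriv]
  change ∑ᶠ b, lineDeriv ℝ (fun q => β.repr (inCoordinates φ s q) b) (φ x) e • β b = _
  simp only [hb]
  conv_rhs => rw [← β.linearCombination_repr (∑ j, fderiv ℝ (f j) (φ x) e • a j),
    Finsupp.linearCombination_apply, Finsupp.sum]
  refine finsum_eq_sum_of_support_subset _ fun b hb => ?_
  rw [Finset.mem_coe, Finsupp.mem_support_iff]
  exact fun h0 => hb (by beta_reduce; rw [h0, zero_smul])

theorem contDiffOn_differentiableAt {N : Set (EuclideanSpace ℝ (Fin n))} (hN : IsOpen N)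
    {z : EuclideanSpace ℝ (Fin n)} (hz : z ∈ N) {f : EuclideanSpace ℝ (Fin n) → ℝ}
    (hf : ContDiffOn ℝ ((⊤ : ℕ∞) : WithTop ℕ∞) f N) : DifferentiableAt ℝ f z :=
  (hf.differentiableOn (by simp)).differentiableAt (hN.mem_nhds hz)

theorem IsSmoothSection.partialDeriv (hV : (V : Set M) ⊆ φ.source) {s : V → A}
    (hs : IsSmoothSection φ s) (i : Fin n) :
    IsSmoothSection φ (GradedGeometry.partialDeriv φ i s) := by
  intro x
  obtain ⟨N, hN, hx, q, f, a, hf, h⟩ := hs.exists_isOpen x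
  refine ⟨N, hN.mem_nhds hx, q, fun j z => fderiv ℝ (f j) z (EuclideanSpace.single i 1), a,
    fun j => ?_, fun y hy => ?_⟩
  · exact ((hf j).fderiv_of_isOpen hN le_rfl).clm_apply contDiffOn_const
  · exact partialDeriv_eq_sum hV (hN.mem_nhds hy)
      (fun j => contDiffOn_differentiableAt hN hy (hf j)) h i

/-- Partial derivatives commute with constant linear maps. -/
theorem partialDeriv_map (hV : (V : Set M) ⊆ φ.source) {s : V → A} (hs : IsSmoothSection φ s)
    (T : A →ₗ[ℝ] B) (i : Fin n) (x : V) :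
    partialDeriv φ i (fun y => T (s y)) x = T (partialDeriv φ i s x) := by
  obtain ⟨N, hN, hx, q, f, a, hf, h⟩ := hs.exists_isOpen x
  have hd := fun j => contDiffOn_differentiableAt hN hx (hf j)
  rw [partialDeriv_eq_sum hV (hN.mem_nhds hx) hd h i,
    partialDeriv_eq_sum hV (hN.mem_nhds hx) (a := fun j => T (a j)) hd
      (fun y hy => by simp [h y hy]) i]
  simp

theorem partialDeriv_add (hV : (V : Set M) ⊆ φ.source) {s t : V → A} (hs : IsSmoothSection φ s)
    (ht : IsSmoothSection φ t) (i : Fin n) (x : V) :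
    partialDeriv φ i (fun y => s y + t y) x = partialDeriv φ i s x + partialDeriv φ i t x := by
  obtain ⟨N, hN, hx, q, f, a, hf, h⟩ := hs.exists_isOpen x
  obtain ⟨N', hN', hx', q', f', a', hf', h'⟩ := ht.exists_isOpen x
  have hd := fun j => contDiffOn_differentiableAt hN hx (hf j)
  have hd' := fun j => contDiffOn_differentiableAt hN' hx' (hf' j)
  rw [partialDeriv_eq_sum hV (hN.mem_nhds hx) hd h i,
    partialDeriv_eq_sum hV (hN'.mem_nhds hx') hd' h' i,
    partialDeriv_eq_sum hV (Filter.inter_mem (hN.mem_nhds hx) (hN'.mem_nhds hx'))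
      (f := Sum.elim f f') (a := Sum.elim a a') (by rintro (j | j); exacts [hd j, hd' j])
      (fun y hy => by simp [h y hy.1, h' y hy.2]) i]
  simp

/-- The partial derivatives of a section with values in a linear subspace have values in it. -/
theorem partialDeriv_mem (hV : (V : Set M) ⊆ φ.source) {s : V → A} (hs : IsSmoothSection φ s)
    {H : Submodule ℝ A} (h : ∀ y, s y ∈ H) (i : Fin n) (x : V) : partialDeriv φ i s x ∈ H := by
  -- the section vanishes modulo `H`, and differentiation commutes with the projection to `A ⧸ H`
  have h0 : (fun y => H.mkQ (s y)) = fun y => (0 : A →ₗ[ℝ] A ⧸ H) (s y) :=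
    funext fun y => by simpa using h y
  have h1 := partialDeriv_map hV hs H.mkQ i x
  rw [h0, partialDeriv_map hV hs] at h1
  simpa using h1.symm

end Local

variable {M : Type u} [TopologicalSpace M]

/-! ### Differential and Euler contraction in a chart -/

namespace Chart

variable {X : GradedRingedSpace.{u, v} M} (c : Chart X) {V : Opens M}

theorem dx_mem_homog (i : Fin c.n ⊕ Fin c.r) :
    c.dx i ∈ GSym.homog c.totalDeg c.totalDeg (c.coordDeg i + 1) :=
  GSym.gen_mem_homog (deg := c.totalDeg) c.totalDeg (Sum.inr i)

/-- The values of the contraction with the Euler vector field on the generators of the fibre: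
`x j ↦ 0` and `dx i ↦ |x i| x i`, which is zero for a base coordinate since `|x i| = 0`. -/
noncomputable def eulerValue : Fin c.r ⊕ (Fin c.n ⊕ Fin c.r) → c.Fibre :=
  Sum.elim 0 (Sum.elim 0 fun j => (c.deg j : ℝ) • GSym.gen c.totalDeg (Sum.inl j))

theorem eulerValue_mem_homog (j : Fin c.r ⊕ (Fin c.n ⊕ Fin c.r)) :
    c.eulerValue j ∈ GSym.homog c.totalDeg c.totalDeg (c.totalDeg j + -1) := by
  rcases j with j | i | j
  · exact Submodule.zero_mem _
  · exact Submodule.zero_mem _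
  · have h : c.totalDeg (Sum.inr (Sum.inr j)) + -1 = c.totalDeg (Sum.inl j) := by
      simp [totalDeg, coordDeg]
    rw [h]
    exact Submodule.smul_mem _ _ (GSym.gen_mem_homog c.totalDeg (Sum.inl j))

/-- The contraction with the graded Euler vector field, as a linear map of the fibre. It does not
depend on the point of the base because the base coordinates have degree `0`. -/
noncomputable def eulerContraction : c.Fibre →ₗ[ℝ] c.Fibre :=
  GSym.superDer (-1) c.eulerValue c.eulerValue_mem_homog

theorem incl_gen (j : Fin c.r) : c.incl (GSym.gen c.deg j) = GSym.gen c.totalDeg (Sum.inl j) :=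
  GSym.rename_gen _ _ j

theorem contract_euler (s : V → c.Fibre) (y : V) :
    contract (c.euler V) s y = c.eulerContraction (s y) := by
  refine LinearMap.congr_fun (GSym.superDer_congr _ _ _ (by norm_num) ?_) (s y)
  funext j
  rcases j with j | i | j
  · rfl
  · simp [eulerValue, euler, coordDeg]
  · simp [eulerValue, euler, coordDeg, coord, incl_gen]

theorem eulerContraction_incl {m : ℤ} {a : GSym c.deg} (ha : a ∈ GSym.homog c.deg c.deg m) :
    c.eulerContraction (c.incl a) = 0 :=
  GSym.superDer_rename_eq_zero _ _ _ _ _ (fun _ => rfl) ha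

theorem eulerContraction_dx_base_mul (i : Fin c.n) (a : c.Fibre) :
    c.eulerContraction (c.dx (Sum.inl i) * a) = -(c.dx (Sum.inl i) * c.eulerContraction a) := by
  have h := GSym.superDer_gen_mul _ _ c.eulerValue_mem_homog (Sum.inr (Sum.inl i)) a
  have h0 : c.eulerValue (Sum.inr (Sum.inl i)) = 0 := rfl
  have h1 : c.totalDeg (Sum.inr (Sum.inl i)) = 1 := by simp [totalDeg, coordDeg]
  have h2 : (-1 : ℝ) ^ (-1 * (1 : ℤ)) = -1 := by norm_num
  rw [h0, h1, h2, zero_mul, zero_add, neg_one_smul] at h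
  exact h

theorem dFibre_mem_homog {m : ℤ} {a : c.Fibre} (ha : a ∈ GSym.homog c.totalDeg c.totalDeg m) :
    c.dFibre a ∈ GSym.homog c.totalDeg c.totalDeg (m + 1) :=
  GSym.superDer_mem_homog _ _ _ ha

/-- Cartan's formula on the fibre: the Lie derivative along the Euler vector field multiplies an
element of degree `m` by `m`. -/
theorem eulerContraction_dFibre_add {m : ℤ} {a : c.Fibre}
    (ha : a ∈ GSym.homog c.totalDeg c.degree m) :
    c.eulerContraction (c.dFibre a) + c.dFibre (c.eulerContraction a) = (m : ℝ) • a := by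
  refine GSym.superDer_anticommutator _ _ _ _ c.degree (fun j => ?_) ha
  change c.eulerContraction _ + c.dFibre _ = _
  rcases j with j | i | j
  · change c.eulerContraction (GSym.gen c.totalDeg (Sum.inr (Sum.inr j))) + c.dFibre 0 = _
    have h : c.degree (Sum.inl j) = c.deg j := by simp [degree, totalDeg, formDeg]
    rw [map_zero, add_zero, h]
    exact GSym.superDer_gen _ _ _ _
  · change c.eulerContraction 0 + c.dFibre 0 = _
    have h : c.degree (Sum.inr (Sum.inl i)) = 0 := by simp [degree, totalDeg, formDeg, coordDeg]
    rw [map_zero, map_zero, h, Int.cast_zero, zero_smul, zero_add]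
  · change c.eulerContraction 0 +
      c.dFibre ((c.deg j : ℝ) • GSym.gen c.totalDeg (Sum.inl j)) = _
    have h : c.degree (Sum.inr (Sum.inr j)) = c.deg j := by
      simp [degree, totalDeg, formDeg, coordDeg]
    rw [map_zero, zero_add, map_smul, h]
    exact congrArg _ (GSym.superDer_gen _ _ _ _)

variable {c}

theorem isSmoothSection_d (hV : V ≤ c.source) {s : V → c.Fibre} (hs : IsSmoothSection c.φ s) :
    IsSmoothSection c.φ (c.d s) :=
  (IsSmoothSection.sum _ fun _ => (IsSmoothSection.const _).mul (hs.partialDeriv hV _)).add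
    (hs.map c.dFibre)

theorem d_add (hV : V ≤ c.source) {s t : V → c.Fibre} (hs : IsSmoothSection c.φ s)
    (ht : IsSmoothSection c.φ t) (y : V) : c.d (fun y => s y + t y) y = c.d s y + c.d t y := by
  simp only [d, partialDeriv_add hV hs ht, map_add, mul_add, Finset.sum_add_distrib]
  abel

theorem d_smul (hV : V ≤ c.source) {s : V → c.Fibre} (hs : IsSmoothSection c.φ s) (r : ℝ) (y : V) :
    c.d (fun y => r • s y) y = r • c.d s y := by
  have h := fun i => partialDeriv_map hV hs (r • LinearMap.id) i y
  simp only [LinearMap.smul_apply, LinearMap.id_apply] at h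
  simp only [d, h, map_smul, mul_smul_comm, smul_add, Finset.smul_sum]

theorem d_mem_homog (hV : V ≤ c.source) {s : V → c.Fibre} (hs : IsSmoothSection c.φ s) {m : ℤ}
    (h : ∀ y, s y ∈ GSym.homog c.totalDeg c.totalDeg m) (y : V) :
    c.d s y ∈ GSym.homog c.totalDeg c.totalDeg (m + 1) := by
  refine add_mem (Submodule.sum_mem _ fun i _ => ?_) (c.dFibre_mem_homog (h y))
  have := GSym.mul_mem_homog (c.dx_mem_homog (Sum.inl i)) (partialDeriv_mem hV hs h i y)
  simpa [coordDeg, add_comm] using this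

/-- Cartan's formula for the Euler vector field, which acts on forms of degree `m` by
multiplication with `m`. -/
theorem eulerContraction_d_add (hV : V ≤ c.source) {s : V → c.Fibre} (hs : IsSmoothSection c.φ s)
    {m : ℤ} {y : V} (h : s y ∈ GSym.homog c.totalDeg c.degree m) :
    c.eulerContraction (c.d s y) + c.d (fun y => c.eulerContraction (s y)) y = (m : ℝ) • s y := by
  rw [← c.eulerContraction_dFibre_add h]
  simp only [d, partialDeriv_map hV hs, map_add, map_sum, eulerContraction_dx_base_mul,
    Finset.sum_neg_distrib]
  -- the terms `dx i * ι (∂ s / ∂ x i)` cancel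
  abel

/-! ### Functions on the manifold as forms -/

variable (c)

theorem expr_add (f g : X.O V) : c.expr V (f + g) = fun y => c.expr V f y + c.expr V g y := by
  funext y; simp [expr]

theorem expr_zero : c.expr V (0 : X.O V) = fun _ => 0 := by
  funext y; simp [expr]

theorem expr_smul (r : ℝ) (f : X.O V) : c.expr V (r • f) = fun y => r • c.expr V f y := by
  funext y; simp [expr]

theorem expr_mul (f g : X.O V) (y) : c.expr V (f * g) y = c.expr V f y * c.expr V g y := by
  simp [expr]

theorem val_res_of_mem_gr {m : ℤ} {f : X.O V} (hf : f ∈ X.gr V m) :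
    IsSmoothSection c.φ (c.val (V ⊓ c.source) inf_le_right (X.res inf_le_left f)) ∧
      ∀ y, c.val (V ⊓ c.source) inf_le_right (X.res inf_le_left f) y ∈ GSym.homog c.deg c.deg m :=
  (c.val_range _ _ m _).1 ⟨_, X.res_mem _ m f hf, rfl⟩

theorem expr_mem_homog {m : ℤ} {f : X.O V} (hf : f ∈ X.gr V m) (y) :
    c.expr V f y ∈ GSym.homog c.totalDeg c.totalDeg m :=
  GSym.rename_mem_homog _ _ ((c.val_res_of_mem_gr hf).2 y)

/-- A function of degree `m` has degree `m` as a form, also when the form degree is not counted. -/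
theorem incl_mem_homog_degree {m : ℤ} {a : GSym c.deg} (ha : a ∈ GSym.homog c.deg c.deg m) :
    c.incl a ∈ GSym.homog c.totalDeg c.degree m := by
  refine GSym.homog_induction (motive := fun m a => c.incl a ∈ GSym.homog c.totalDeg c.degree m)
    (by simpa using GSym.one_mem_homog _) ?_ (by simp) ?_ ?_ ha
  · intro j m a _ h
    have hj : c.degree (Sum.inl j) = c.deg j := by simp [degree, totalDeg, formDeg]
    rw [map_mul, incl_gen, ← hj]
    exact GSym.mul_mem_homog (GSym.gen_mem_homog c.degree (Sum.inl j)) h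
  · intro m a b h h'
    rw [map_add]; exact add_mem h h'
  · intro m r a h
    rw [map_smul]; exact Submodule.smul_mem _ _ h

theorem isSmoothSection_expr (f : X.O V) : IsSmoothSection c.φ (c.expr V f) := by
  induction f using DirectSum.Decomposition.inductionOn (X.gr V) with
  | zero => rw [expr_zero]; exact IsSmoothSection.const _
  | homogeneous f => exact (c.val_res_of_mem_gr f.2).1.map c.incl.toLinearMap
  | add f g hf hg => rw [expr_add]; exact hf.add hg

theorem eulerContraction_expr {m : ℤ} {f : X.O V} (hf : f ∈ X.gr V m) (y) :
    c.eulerContraction (c.expr V f y) = 0 :=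
  c.eulerContraction_incl ((c.val_res_of_mem_gr hf).2 y)

/-- The Euler vector field maps a function `f` of degree `m` to `m f`. -/
theorem eulerContraction_d_expr {m : ℤ} {f : X.O V} (hf : f ∈ X.gr V m) (y) :
    c.eulerContraction (c.d (c.expr V f) y) = (m : ℝ) • c.expr V f y := by
  have h := eulerContraction_d_add inf_le_right (c.isSmoothSection_expr f) (y := y)
    (c.incl_mem_homog_degree ((c.val_res_of_mem_gr hf).2 y))
  have h0 : (fun y => c.eulerContraction (c.expr V f y)) =
      fun y => (0 : ℝ) • c.expr V f y := by
    funext y; rw [c.eulerContraction_expr hf, zero_smul]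
  rwa [h0, d_smul inf_le_right (c.isSmoothSection_expr f), zero_smul, add_zero] at h

theorem d_expr_mem_homog {m : ℤ} {f : X.O V} (hf : f ∈ X.gr V m) (y) :
    c.d (c.expr V f) y ∈ GSym.homog c.totalDeg c.totalDeg (m + 1) :=
  d_mem_homog inf_le_right (c.isSmoothSection_expr f) (c.expr_mem_homog hf) y

theorem d_expr_add (f g : X.O V) (y) :
    c.d (c.expr V (f + g)) y = c.d (c.expr V f) y + c.d (c.expr V g) y := by
  rw [expr_add, d_add inf_le_right (c.isSmoothSection_expr f) (c.isSmoothSection_expr g)]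

theorem d_expr_zero (y) : c.d (c.expr V (0 : X.O V)) y = 0 := by
  simpa using c.d_expr_add (V := V) 0 0 y

/-- The contraction of `f dg dh` with the Euler vector field, for homogeneous functions. -/
theorem eulerContraction_expr_mul_d_mul_d {m m₁ m₂ : ℤ} {f g h : X.O V} (hf : f ∈ X.gr V m)
    (hg : g ∈ X.gr V m₁) (hh : h ∈ X.gr V m₂) (y) :
    c.eulerContraction (c.expr V f y * (c.d (c.expr V g) y * c.d (c.expr V h) y)) =
      c.expr V (((-1 : ℝ) ^ (-1 * m) * m₁) • (f * g)) y * c.d (c.expr V h) y +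
      c.expr V (((-1 : ℝ) ^ (-1 * m) * (-1 : ℝ) ^ (-1 * (m₁ + 1)) * m₂ *
        (-1 : ℝ) ^ ((m₁ + 1) * m₂)) • (f * h)) y * c.d (c.expr V g) y := by
  have hι := c.eulerContraction_expr hf y
  have hιg := c.eulerContraction_d_expr hg y
  have hιh := c.eulerContraction_d_expr hh y
  have h1 := GSym.superDer_mul _ _ c.eulerValue_mem_homog (c.expr_mem_homog hf y)
    (c.d (c.expr V g) y * c.d (c.expr V h) y)
  have h2 := GSym.superDer_mul _ _ c.eulerValue_mem_homog (c.d_expr_mem_homog hg y)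
    (c.d (c.expr V h) y)
  rw [eulerContraction] at hι hιg hιh ⊢
  rw [h1, h2, hι, hιg, hιh, zero_mul, zero_add, mul_smul_comm,
    GSym.homog_mul_homog (c.d_expr_mem_homog hg y) (c.expr_mem_homog hh y), expr_smul, expr_smul]
  simp only [expr_mul, mul_add, smul_add, smul_smul, mul_smul_comm, smul_mul_assoc, mul_assoc]

end Chart

/-! ### Global forms -/

namespace GradedManifold

variable {X : GradedManifold.{u, v} M}

/-- The family `η` of expressions over the parts of the charts in `V` comes from a finite sum
`∑ f_a dg_a` of one-forms over `V`. -/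
def IsOneFormOn (V : Opens M)
    (η : ∀ c : Chart X.toGradedRingedSpace, ↥(V ⊓ c.source) → c.Fibre) : Prop :=
  ∃ (q : ℕ) (f g : Fin q → X.O V), ∀ (c : Chart X.toGradedRingedSpace) (y : ↥(V ⊓ c.source)),
    η c y = ∑ a, c.expr V (f a) y * c.d (c.expr V (g a)) y

namespace IsOneFormOn

variable {V : Opens M} {η θ : ∀ c : Chart X.toGradedRingedSpace, ↥(V ⊓ c.source) → c.Fibre}

theorem congr (h : IsOneFormOn V η) (hθ : ∀ c y, θ c y = η c y) : IsOneFormOn V θ := by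
  obtain rfl : θ = η := funext fun c => funext (hθ c)
  exact h

theorem zero : IsOneFormOn (X := X) V fun _ _ => 0 :=
  ⟨0, Fin.elim0, Fin.elim0, fun _ _ => by simp⟩

theorem mul_d (f g : X.O V) :
    IsOneFormOn V fun c y => c.expr V f y * c.d (c.expr V g) y :=
  ⟨1, fun _ => f, fun _ => g, fun _ _ => by simp⟩

theorem add (h : IsOneFormOn V η) (h' : IsOneFormOn V θ) :
    IsOneFormOn V fun c y => η c y + θ c y := by
  obtain ⟨q, f, g, h⟩ := h
  obtain ⟨q', f', g', h'⟩ := h'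
  refine ⟨q + q', Fin.append f f', Fin.append g g', fun c y => ?_⟩
  simp [h, h', Fin.sum_univ_add]

theorem sum {ι : Type} (S : Finset ι)
    {η : ι → ∀ c : Chart X.toGradedRingedSpace, ↥(V ⊓ c.source) → c.Fibre}
    (h : ∀ i, IsOneFormOn V (η i)) : IsOneFormOn V fun c y => ∑ i ∈ S, η i c y := by
  classical
  induction S using Finset.induction_on with
  | empty => simpa using zero
  | insert i S hi ih => simpa [Finset.sum_insert hi] using (h i).add ih

/-- Over `V` each function is a finite sum of homogeneous ones, and for homogeneous `g` of degree `m`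
the function `ι_E dg = m g` is defined without reference to a chart. -/
theorem eulerContraction_mul_d_mul_d (f g h : X.O V) : IsOneFormOn V fun c y =>
    c.eulerContraction (c.expr V f y * (c.d (c.expr V g) y * c.d (c.expr V h) y)) := by
  induction f using DirectSum.Decomposition.inductionOn (X.gr V) with
  | zero => exact zero.congr fun c y => by simp [Chart.expr_zero]
  | add f f' hf hf' => exact (hf.add hf').congr fun c y => by simp [Chart.expr_add, add_mul]
  | homogeneous f =>
  induction g using DirectSum.Decomposition.inductionOn (X.gr V) with
  | zero => exact zero.congr fun c y => by simp [Chart.d_expr_zero]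
  | add g g' hg hg' =>
    exact (hg.add hg').congr fun c y => by simp [Chart.d_expr_add, add_mul, mul_add]
  | homogeneous g =>
  induction h using DirectSum.Decomposition.inductionOn (X.gr V) with
  | zero => exact zero.congr fun c y => by simp [Chart.d_expr_zero]
  | add h h' hh hh' => exact (hh.add hh').congr fun c y => by simp [Chart.d_expr_add, mul_add]
  | homogeneous h =>
    exact ((mul_d _ _).add (mul_d _ _)).congr fun c y =>
      c.eulerContraction_expr_mul_d_mul_d f.2 g.2 h.2 y

end IsOneFormOn

theorem isForm_one_iff {α : X.LocalForms} : IsForm 1 α ↔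
    ∀ x : M, ∃ V : Opens M, x ∈ V ∧ IsOneFormOn V fun c y => α c ⟨y, y.2.2⟩ := by
  refine forall_congr' fun x => exists_congr fun V => and_congr_right fun _ => ?_
  constructor
  · rintro ⟨q, f, g, h⟩
    exact ⟨q, f, fun a => g a 0, fun c y => by simpa using h c y⟩
  · rintro ⟨q, f, g, h⟩
    exact ⟨q, f, fun a _ => g a, fun c y => by simpa using h c y⟩

theorem IsForm.smul {α : X.LocalForms} (h : IsForm 1 α) (r : ℝ) : IsForm 1 (r • α) := by
  intro x
  obtain ⟨V, hx, q, f, g, h⟩ := h x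
  refine ⟨V, hx, q, fun a => r • f a, g, fun c y => ?_⟩
  simp [h, Chart.expr_smul, Finset.smul_sum]

/-- The expression of a two-form in a chart is smooth. -/
theorem IsForm.isSmoothSection {ω : X.LocalForms} (h : IsForm 2 ω)
    (c : Chart X.toGradedRingedSpace) : IsSmoothSection c.φ (ω c) := by
  refine .of_local le_rfl fun x => ?_
  obtain ⟨V, hx, q, f, g, h⟩ := h x
  refine ⟨V ⊓ c.source, inf_le_right, ⟨hx, x.2⟩, ?_⟩
  have : (fun y : ↥(V ⊓ c.source) => ω c ⟨y, y.2.2⟩) = fun y => ∑ a, c.expr V (f a) y *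
      (c.d (c.expr V (g a 0)) y * c.d (c.expr V (g a 1)) y) := by
    funext y; simp [h]
  rw [this]
  exact IsSmoothSection.sum _ fun a => (c.isSmoothSection_expr _).mul
    ((Chart.isSmoothSection_d inf_le_right (c.isSmoothSection_expr _)).mul
      (Chart.isSmoothSection_d inf_le_right (c.isSmoothSection_expr _)))

theorem IsForm.contractEuler {ω : X.LocalForms} (h : IsForm 2 ω) :
    IsForm 1 (contractEuler ω) := by
  refine isForm_one_iff.2 fun x => ?_
  obtain ⟨V, hx, q, f, g, h⟩ := h x
  refine ⟨V, hx, (IsOneFormOn.sum Finset.univ fun a =>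
    IsOneFormOn.eulerContraction_mul_d_mul_d (f a) (g a 0) (g a 1)).congr fun c y => ?_⟩
  rw [GradedManifold.contractEuler, Chart.contract_euler, h]
  simp

/-- Cartan's formula for a closed two-form of degree `k`. -/
theorem d_contractEuler {k : ℤ} {ω : X.LocalForms} (h : IsForm 2 ω) (hk : IsHomogeneous k ω)
    (hd : d ω = 0) : d (contractEuler ω) = (k : ℝ) • ω := by
  funext c y
  have h1 := Chart.eulerContraction_d_add le_rfl (h.isSmoothSection c) (hk c y)
  have h2 : c.d (ω c) y = 0 := congrFun (congrFun hd c) y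
  rw [h2, map_zero, zero_add] at h1
  have h3 : contractEuler ω c = fun y => c.eulerContraction (ω c y) :=
    funext fun y => c.contract_euler (ω c) y
  change c.d (contractEuler ω c) y = (k : ℝ) • ω c y
  rw [h3, h1]

theorem d_smul_contractEuler {ω : X.LocalForms} (h : IsForm 2 ω) (r : ℝ) :
    d (r • contractEuler ω) = r • d (contractEuler ω) := by
  funext c y
  have h3 : contractEuler ω c = fun y => c.eulerContraction (ω c y) :=
    funext fun y => c.contract_euler (ω c) y
  have hs : IsSmoothSection c.φ (contractEuler ω c) := by
    rw [h3]; exact (h.isSmoothSection c).map _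
  exact Chart.d_smul le_rfl hs r y

end GradedManifold

end GradedGeometry

open GradedGeometry GradedManifold in
theorem mainTheorem1 {M : Type u} [TopologicalSpace M] (X : GradedManifold.{u, v} M)
    (k : ℤ) (hk : k ≠ 0) (ω : X.LocalForms) (hω : IsGradedSymplectic k ω) :
    IsExact ω ∧ IsForm 1 (contractEuler ω) ∧ ω = (k : ℝ)⁻¹ • d (contractEuler ω) := by
  have hα := hω.isForm.contractEuler
  have h : ω = (k : ℝ)⁻¹ • d (contractEuler ω) := by
    rw [d_contractEuler hω.isForm hω.homogeneous hω.closed,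
      inv_smul_smul₀ (Int.cast_ne_zero.2 hk)]
  exact ⟨⟨(k : ℝ)⁻¹ • contractEuler ω, hα.smul _,
    (d_smul_contractEuler hω.isForm _).trans h.symm⟩, hα, h⟩
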